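/- Let $\kappa>0$ and $D_\kappa=\pi/\sqrt{\kappa}$. Let $(M,d)$ be a complete $\mathrm{CAT}(\kappa)$ space with $\operatorname{diam}(M)<D_\kappa/2$, and let $A,B\subseteq M$ be nonempty closed convex subsets with $A\cap B\neq\emptyset$. Here a subset $C\subseteq M$ is called convex if any two points of $C$ are joined by a geodesic of $M$ and every geodesic of $M$ joining two points of $C$ is contained in $C$. For a nonempty closed convex set $C\subseteq M$ let $P_C:M\to C$ denote the metric projection, i.e. $P_C(x)$ is the unique point of $C$ with $d(x,P_C(x))=d(x,C)=\inf_{c\in C}d(x,c)$. Let $x_0\in M$ be any starting point, and let $\{x_n\}$ be the sequence produced by the alternating projection method, $$x_{2n-1}=P_A(x_{2n-2}),\qquad x_{2n}=P_B(x_{2n-1}),\qquad n\in\mathbb{N},\ n\ge 1.$$ If $A$ or $B$ is locally compact (in the subspace topology), then $\{x_n\}$ converges in the metric $d$ to a point $x\in A\cap B$. -/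

import Mathlib

open Filter Topology

namespace CatKappa

/-- The number `D_κ = π / √κ` (used for `κ > 0`). -/
noncomputable def modelDiam (κ : ℝ) : ℝ := Real.pi / Real.sqrt κ

/-- `γ`, restricted to `[0, 1]`, is a geodesic from `x` to `y` for the distance function `d`. -/
def IsGeodesic {X : Type*} (d : X → X → ℝ) (γ : ℝ → X) (x y : X) : Prop :=
  γ 0 = x ∧ γ 1 = y ∧
    ∀ s ∈ Set.Icc (0 : ℝ) 1, ∀ t ∈ Set.Icc (0 : ℝ) 1, d (γ s) (γ t) = d x y * |s - t|

/-- The geodesic segment: the image of `[0, 1]` under the path `γ`. -/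
def segmentOf {X : Type*} (γ : ℝ → X) : Set X := γ '' Set.Icc (0 : ℝ) 1

/-- The unit sphere `𝕊²` in Euclidean `ℝ³`, the point set of the model space. -/
abbrev ModelSphere : Type := Metric.sphere (0 : EuclideanSpace ℝ (Fin 3)) 1

/-- The distance of the model space `M_κ²`: the angular distance on `𝕊²`
multiplied by `1 / √κ`. -/
noncomputable def modelDist (κ : ℝ) (u v : ModelSphere) : ℝ :=
  (1 / Real.sqrt κ) *
    Real.arccos (inner ℝ (u : EuclideanSpace ℝ (Fin 3)) (v : EuclideanSpace ℝ (Fin 3)))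

/-- A geodesic triangle for the distance `d`: three vertices, the side `γ i` being a geodesic
from `v i` to `v (i + 1)` (indices modulo 3). -/
def IsGeodesicTriangle {X : Type*} (d : X → X → ℝ) (v : Fin 3 → X) (γ : Fin 3 → ℝ → X) : Prop :=
  ∀ i, IsGeodesic d (γ i) (v i) (v (i + 1))

/-- The geodesic triangle `(v', γ')` of `M_κ²` is a comparison triangle for the triangle of `M`
with vertices `v`. -/
def IsComparisonTriangle {M : Type*} [MetricSpace M] (κ : ℝ) (v : Fin 3 → M)
    (v' : Fin 3 → ModelSphere) (γ' : Fin 3 → ℝ → ModelSphere) : Prop :=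
  IsGeodesicTriangle (modelDist κ) v' γ' ∧ ∀ i j, dist (v i) (v j) = modelDist κ (v' i) (v' j)

/-- The `CAT(κ)` inequality for the geodesic triangle `(v, γ)`: if `p`, `q` lie on the sides
`γ i`, `γ j` and `p'`, `q'` are comparison points for them on the corresponding sides of a
comparison triangle, then `d(p, q) ≤ ρ(p', q')`. -/
def SatisfiesCATInequality {M : Type*} [MetricSpace M] (κ : ℝ) (v : Fin 3 → M)
    (γ : Fin 3 → ℝ → M) : Prop :=
  ∀ (v' : Fin 3 → ModelSphere) (γ' : Fin 3 → ℝ → ModelSphere), IsComparisonTriangle κ v v' γ' →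
    ∀ (i j : Fin 3), ∀ p ∈ segmentOf (γ i), ∀ q ∈ segmentOf (γ j),
      ∀ p' ∈ segmentOf (γ' i), ∀ q' ∈ segmentOf (γ' j),
        dist p (v i) = modelDist κ p' (v' i) → dist q (v j) = modelDist κ q' (v' j) →
          dist p q ≤ modelDist κ p' q'

/-- `M` is a `CAT(κ)` space (for `κ > 0`): it is `D_κ`-geodesic and every geodesic triangle of
perimeter less than `2 D_κ` satisfies the `CAT(κ)` inequality. -/
def IsCAT (κ : ℝ) (M : Type*) [MetricSpace M] : Prop :=
  (∀ x y : M, dist x y < modelDiam κ → ∃ γ : ℝ → M, IsGeodesic dist γ x y) ∧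
  ∀ (v : Fin 3 → M) (γ : Fin 3 → ℝ → M), IsGeodesicTriangle dist v γ →
    dist (v 0) (v 1) + dist (v 1) (v 2) + dist (v 2) (v 0) < 2 * modelDiam κ →
      SatisfiesCATInequality κ v γ

/-- Convexity: any two points of `C` are joined by a geodesic of `M`, and every such geodesic
is contained in `C`. -/
def IsConvex {M : Type*} [MetricSpace M] (C : Set M) : Prop :=
  ∀ x ∈ C, ∀ y ∈ C, (∃ γ : ℝ → M, IsGeodesic dist γ x y) ∧
    ∀ γ : ℝ → M, IsGeodesic dist γ x y → segmentOf γ ⊆ C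

/-- `p` is a nearest point of `C` to `x`: `p ∈ C` and `d(x, p) = d(x, C)`. -/
def IsNearestPoint {M : Type*} [MetricSpace M] (C : Set M) (x p : M) : Prop :=
  p ∈ C ∧ dist x p = Metric.infDist x C

open Classical in
/-- The metric projection `P_C`, sending `x` to its nearest point in `C` (with the value `x`
if there is no nearest point; for a nonempty closed convex subset of a complete `CAT(κ)` space
of diameter less than `D_κ / 2` the nearest point exists and is unique). -/
noncomputable def metricProj {M : Type*} [MetricSpace M] (C : Set M) (x : M) : M :=
  if h : ∃ p, IsNearestPoint C x p then h.choose else x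

/-- `x` is the alternating projection sequence of `A`, `B` with starting point `x 0`:
`x_{2n-1} = P_A (x_{2n-2})` and `x_{2n} = P_B (x_{2n-1})` for `n ≥ 1`. -/
def IsAlternatingProjectionSeq {M : Type*} [MetricSpace M] (A B : Set M) (x : ℕ → M) : Prop :=
  ∀ n : ℕ, x (2 * n + 1) = metricProj A (x (2 * n)) ∧
    x (2 * n + 2) = metricProj B (x (2 * n + 1))

end CatKappa

/-!
By comparison with a triangle on the unit sphere, the spherical Stewart formula holds in a `CAT(κ)`
space as an inequality for `cos (√κ * d)` along a geodesic. At the midpoint it forces minimizing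
sequences for the distance to a complete convex set to be Cauchy, so nearest points exist.
Differentiated at the nearest point `p` of `x` it gives the Pythagorean inequality `cos (√κ d(x, z))
≤ cos (√κ d(x, p)) cos (√κ d(p, z))` for all `z` in the set.

If `z` lies in all the sets, the distances `d(x n, z)` therefore decrease, and comparing the two
sides of the Pythagorean inequality in the limit gives `d(x n, x (n + 1)) → 0`. A locally compact
complete convex set is a length space, so its closed balls are compact by the Hopf–Rinow theorem,
and the sequence, which visits it again and again, has a cluster point. As consecutive terms
approach each other, this cluster point lies in both sets, and since the distance to it decreases as
well, the whole sequence converges to it.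
-/

namespace CatKappa

open InnerProductGeometry Real
open scoped RealInnerProductSpace

section UnitVectors

variable {E : Type*} [NormedAddCommGroup E] [InnerProductSpace ℝ E] {u v : E}

theorem cos_angle_of_norm_eq_one (hu : ‖u‖ = 1) (hv : ‖v‖ = 1) : cos (angle u v) = ⟪u, v⟫ := by
  rw [cos_angle, hu, hv, mul_one, div_one]

theorem angle_eq_of_inner_eq_cos (hu : ‖u‖ = 1) (hv : ‖v‖ = 1) {a : ℝ} (ha₀ : 0 ≤ a) (ha : a ≤ π)
    (h : ⟪u, v⟫ = cos a) : angle u v = a :=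
  injOn_cos ⟨angle_nonneg u v, angle_le_pi u v⟩ ⟨ha₀, ha⟩
    ((cos_angle_of_norm_eq_one hu hv).trans h)

theorem eq_of_angle_eq_zero (hu : ‖u‖ = 1) (hv : ‖v‖ = 1) (h : angle u v = 0) : u = v := by
  rw [← inner_eq_one_iff_of_norm_eq_one (𝕜 := ℝ) hu hv, ← cos_angle_of_norm_eq_one hu hv, h,
    cos_zero]

/-- Spherical linear interpolation: for unit vectors `u`, `v` that are neither equal nor opposite,
`t ↦ slerp u v t` runs through the great circle arc from `u` to `v` at constant speed `angle u v`.
It has the junk value `0` if `u` and `v` are parallel. -/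
noncomputable def slerp (u v : E) (t : ℝ) : E :=
  (sin (angle u v))⁻¹ • (sin ((1 - t) * angle u v) • u + sin (t * angle u v) • v)

theorem slerp_zero (huv : sin (angle u v) ≠ 0) : slerp u v 0 = u := by
  simp [slerp, smul_smul, huv]

theorem slerp_one (huv : sin (angle u v) ≠ 0) : slerp u v 1 = v := by
  simp [slerp, smul_smul, huv]

theorem sin_angle_mul_inner_slerp (huv : sin (angle u v) ≠ 0) (w : E) (t : ℝ) :
    sin (angle u v) * ⟪w, slerp u v t⟫ =
      sin ((1 - t) * angle u v) * ⟪w, u⟫ + sin (t * angle u v) * ⟪w, v⟫ := by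
  rw [slerp, inner_smul_right, mul_inv_cancel_left₀ huv, inner_add_right, inner_smul_right,
    inner_smul_right]

theorem inner_slerp_slerp (hu : ‖u‖ = 1) (hv : ‖v‖ = 1) (huv : sin (angle u v) ≠ 0) (s t : ℝ) :
    ⟪slerp u v s, slerp u v t⟫ = cos ((s - t) * angle u v) := by
  have huu : ⟪u, u⟫ = 1 := by rw [real_inner_self_eq_norm_sq, hu, one_pow]
  have hvv : ⟪v, v⟫ = 1 := by rw [real_inner_self_eq_norm_sq, hv, one_pow]
  have hcos : ⟪u, v⟫ = cos (angle u v) := (cos_angle_of_norm_eq_one hu hv).symm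
  have hu_slerp : ⟪u, slerp u v s⟫ = cos (s * angle u v) := by
    refine mul_left_cancel₀ huv ?_
    rw [sin_angle_mul_inner_slerp huv, huu, hcos, sub_mul, one_mul, sin_sub]
    ring
  have hv_slerp : ⟪v, slerp u v s⟫ = cos ((1 - s) * angle u v) := by
    refine mul_left_cancel₀ huv ?_
    rw [sin_angle_mul_inner_slerp huv, hvv, real_inner_comm u v, hcos, sub_mul, one_mul, sin_sub,
      cos_sub]
    linear_combination -sin (s * angle u v) * sin_sq_add_cos_sq (angle u v)
  refine mul_left_cancel₀ huv ?_
  rw [sin_angle_mul_inner_slerp huv, real_inner_comm, hu_slerp, real_inner_comm, hv_slerp]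
  simp only [sub_mul, one_mul, sin_sub, cos_sub]
  ring

theorem norm_slerp (hu : ‖u‖ = 1) (hv : ‖v‖ = 1) (huv : sin (angle u v) ≠ 0) (t : ℝ) :
    ‖slerp u v t‖ = 1 := by
  rw [norm_eq_sqrt_real_inner, inner_slerp_slerp hu hv huv, sub_self, zero_mul, cos_zero, sqrt_one]

end UnitVectors

section ComparisonTriangle

theorem abs_cos_sub_cos_mul_cos_le {a b c : ℝ} (hb : |a - c| ≤ b) (hb' : b ≤ a + c)
    (hper : a + b + c ≤ 2 * π) : |cos b - cos a * cos c| ≤ sin a * sin c := by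
  have hb₀ : 0 ≤ b := (abs_nonneg _).trans hb
  have hlower : cos (a + c) ≤ cos b := by
    rcases le_total (a + c) π with h | h
    · exact cos_le_cos_of_nonneg_of_le_pi hb₀ h hb'
    · rw [← cos_two_pi_sub (a + c)]
      exact cos_le_cos_of_nonneg_of_le_pi hb₀ (by linarith) (by linarith)
  have hupper : cos b ≤ cos (a - c) := by
    rw [← cos_abs (a - c)]
    exact cos_le_cos_of_nonneg_of_le_pi (abs_nonneg _) (by linarith) hb
  rw [cos_add] at hlower
  rw [cos_sub] at hupper
  exact abs_le.2 ⟨by linarith, by linarith⟩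

theorem exists_modelSphere_angle_eq {a b c : ℝ} (ha : a ≤ b + c) (hb : b ≤ c + a) (hc : c ≤ a + b)
    (hper : a + b + c ≤ 2 * π) :
    ∃ u v w : ModelSphere, angle (u : EuclideanSpace ℝ (Fin 3)) v = a ∧
      angle (v : EuclideanSpace ℝ (Fin 3)) w = b ∧ angle (w : EuclideanSpace ℝ (Fin 3)) u = c := by
  have hsin_a : 0 ≤ sin a := sin_nonneg_of_nonneg_of_le_pi (by linarith) (by linarith)
  have hsin_b : 0 ≤ sin b := sin_nonneg_of_nonneg_of_le_pi (by linarith) (by linarith)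
  have habs : |cos c - cos a * cos b| ≤ sin a * sin b :=
    abs_cos_sub_cos_mul_cos_le (abs_le.2 ⟨by linarith, by linarith⟩) hc (by linarith)
  -- The second coordinate of `u`, if `v = (1, 0, 0)` and `w = (cos b, sin b, 0)`.
  set s := (cos c - cos a * cos b) / sin b with hs
  have hs_mul : s * sin b = cos c - cos a * cos b :=
    div_mul_cancel_of_imp fun h => abs_nonpos_iff.1 (habs.trans_eq (by rw [h, mul_zero]))
  have hs_sq : s ^ 2 ≤ sin a ^ 2 := by
    rw [← sq_abs s, hs, abs_div, abs_of_nonneg hsin_b]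
    gcongr
    exact div_le_of_le_mul₀ hsin_b hsin_a habs
  have hrest : 0 ≤ 1 - cos a ^ 2 - s ^ 2 := by linarith [sin_sq_add_cos_sq a]
  have hu : ‖(!₂[cos a, s, √(1 - cos a ^ 2 - s ^ 2)] : EuclideanSpace ℝ (Fin 3))‖ = 1 := by
    simp [EuclideanSpace.norm_eq, Fin.sum_univ_three, sq_sqrt hrest]
  have hv : ‖(!₂[1, 0, 0] : EuclideanSpace ℝ (Fin 3))‖ = 1 := by
    simp [EuclideanSpace.norm_eq, Fin.sum_univ_three]
  have hw : ‖(!₂[cos b, sin b, 0] : EuclideanSpace ℝ (Fin 3))‖ = 1 := by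
    simp [EuclideanSpace.norm_eq, Fin.sum_univ_three]
  refine ⟨⟨_, mem_sphere_zero_iff_norm.2 hu⟩, ⟨_, mem_sphere_zero_iff_norm.2 hv⟩,
    ⟨_, mem_sphere_zero_iff_norm.2 hw⟩,
    angle_eq_of_inner_eq_cos hu hv (by linarith) (by linarith) ?_,
    angle_eq_of_inner_eq_cos hv hw (by linarith) (by linarith) ?_,
    angle_eq_of_inner_eq_cos hw hu (by linarith) (by linarith) ?_⟩
  · simp [PiLp.inner_apply, Fin.sum_univ_three]
  · simp [PiLp.inner_apply, Fin.sum_univ_three]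
  · simp only [PiLp.inner_apply, RCLike.inner_apply, ringHom_apply, Fin.sum_univ_three,
      Fin.isValue, Matrix.cons_val_zero, Matrix.cons_val_one, Matrix.cons_val, mul_zero, add_zero]
    linarith

end ComparisonTriangle

section ModelSpace

variable {κ : ℝ}

theorem sqrt_mul_modelDiam (hκ : 0 < κ) : √κ * modelDiam κ = π :=
  mul_div_cancel₀ π (sqrt_pos.2 hκ).ne'

theorem sqrt_mul_lt_pi (hκ : 0 < κ) {r : ℝ} (hr : r < modelDiam κ) : √κ * r < π := by
  rw [← sqrt_mul_modelDiam hκ]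
  exact mul_lt_mul_of_pos_left hr (sqrt_pos.2 hκ)

theorem modelDist_eq_angle_div_sqrt (κ : ℝ) (u v : ModelSphere) :
    modelDist κ u v = angle (u : EuclideanSpace ℝ (Fin 3)) v / √κ := by
  rw [modelDist, angle, norm_eq_of_mem_sphere u, norm_eq_of_mem_sphere v, mul_one, div_one,
    one_div_mul_eq_div]

theorem sqrt_mul_modelDist (hκ : 0 < κ) (u v : ModelSphere) :
    √κ * modelDist κ u v = angle (u : EuclideanSpace ℝ (Fin 3)) v := by
  rw [modelDist_eq_angle_div_sqrt, mul_div_cancel₀ _ (sqrt_pos.2 hκ).ne']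

theorem modelDist_self (κ : ℝ) (u : ModelSphere) : modelDist κ u u = 0 := by
  rw [modelDist_eq_angle_div_sqrt, angle_self (ne_zero_of_mem_unit_sphere u), zero_div]

theorem modelDist_comm (κ : ℝ) (u v : ModelSphere) : modelDist κ u v = modelDist κ v u := by
  rw [modelDist_eq_angle_div_sqrt, modelDist_eq_angle_div_sqrt, angle_comm]

theorem cos_sqrt_mul_modelDist (hκ : 0 < κ) (u v : ModelSphere) :
    cos (√κ * modelDist κ u v) = ⟪(u : EuclideanSpace ℝ (Fin 3)), v⟫ := by
  rw [sqrt_mul_modelDist hκ,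
    cos_angle_of_norm_eq_one (norm_eq_of_mem_sphere u) (norm_eq_of_mem_sphere v)]

theorem exists_modelDist_eq (hκ : 0 < κ) {a b c : ℝ} (ha : a ≤ b + c) (hb : b ≤ c + a)
    (hc : c ≤ a + b) (hper : a + b + c ≤ 2 * modelDiam κ) :
    ∃ u v w : ModelSphere, modelDist κ u v = a ∧ modelDist κ v w = b ∧ modelDist κ w u = c := by
  have hsqrt : 0 < √κ := sqrt_pos.2 hκ
  obtain ⟨u, v, w, huv, hvw, hwu⟩ :=
    exists_modelSphere_angle_eq (a := √κ * a) (b := √κ * b) (c := √κ * c)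
      (by rw [← mul_add]; gcongr) (by rw [← mul_add]; gcongr) (by rw [← mul_add]; gcongr)
      (by rw [← sqrt_mul_modelDiam hκ]; linarith [mul_le_mul_of_nonneg_left hper hsqrt.le])
  refine ⟨u, v, w, ?_, ?_, ?_⟩ <;>
    simp only [modelDist_eq_angle_div_sqrt, huv, hvw, hwu, mul_div_cancel_left₀ _ hsqrt.ne']

/-- The formula is the spherical version of Stewart's theorem. -/
theorem exists_isGeodesic_modelDist (hκ : 0 < κ) {u v : ModelSphere}
    (huv : modelDist κ u v < modelDiam κ) :
    ∃ γ : ℝ → ModelSphere, IsGeodesic (modelDist κ) γ u v ∧ ∀ (w : ModelSphere) (t : ℝ),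
      sin (√κ * modelDist κ u v) * cos (√κ * modelDist κ w (γ t)) =
        sin ((1 - t) * (√κ * modelDist κ u v)) * cos (√κ * modelDist κ w u) +
          sin (t * (√κ * modelDist κ u v)) * cos (√κ * modelDist κ w v) := by
  have hu := norm_eq_of_mem_sphere u
  have hv := norm_eq_of_mem_sphere v
  have hangle_lt : angle (u : EuclideanSpace ℝ (Fin 3)) v < π := by
    rw [← sqrt_mul_modelDist hκ]
    exact sqrt_mul_lt_pi hκ huv
  rcases (angle_nonneg (u : EuclideanSpace ℝ (Fin 3)) v).eq_or_lt with hangle | hangle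
  · obtain rfl : u = v := Subtype.ext (eq_of_angle_eq_zero hu hv hangle.symm)
    exact ⟨fun _ => u, ⟨rfl, rfl, by simp [modelDist_self]⟩, by simp [modelDist_self]⟩
  have hsin : sin (angle (u : EuclideanSpace ℝ (Fin 3)) v) ≠ 0 :=
    (sin_pos_of_pos_of_lt_pi hangle hangle_lt).ne'
  refine ⟨fun t => ⟨slerp u v t, mem_sphere_zero_iff_norm.2 (norm_slerp hu hv hsin t)⟩,
    ⟨Subtype.ext (slerp_zero hsin), Subtype.ext (slerp_one hsin), fun s hs t ht => ?_⟩,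
    fun w t => ?_⟩
  · have habs : |s - t| ≤ 1 := abs_le.2 ⟨by linarith [hs.1, ht.2], by linarith [hs.2, ht.1]⟩
    rw [modelDist_eq_angle_div_sqrt, modelDist_eq_angle_div_sqrt, div_mul_eq_mul_div, mul_comm]
    congr 1
    refine angle_eq_of_inner_eq_cos (norm_slerp hu hv hsin s) (norm_slerp hu hv hsin t)
      (by positivity) ((mul_le_of_le_one_left hangle.le habs).trans hangle_lt.le) ?_
    rw [inner_slerp_slerp hu hv hsin, ← cos_abs, abs_mul, abs_of_pos hangle]
  · rw [cos_sqrt_mul_modelDist hκ, cos_sqrt_mul_modelDist hκ, cos_sqrt_mul_modelDist hκ,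
      sqrt_mul_modelDist hκ]
    exact sin_angle_mul_inner_slerp hsin w t

theorem cos_sqrt_mul_le_cos_sqrt_mul_iff (hκ : 0 < κ) {r s : ℝ} (hr₀ : 0 ≤ r)
    (hr : r ≤ modelDiam κ) (hs₀ : 0 ≤ s) (hs : s ≤ modelDiam κ) :
    cos (√κ * r) ≤ cos (√κ * s) ↔ s ≤ r := by
  have hsqrt : 0 < √κ := sqrt_pos.2 hκ
  rw [strictAntiOn_cos.le_iff_ge, mul_le_mul_iff_right₀ hsqrt] <;>
    rw [← sqrt_mul_modelDiam hκ] <;> constructor <;> first | positivity | gcongr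

theorem cos_sqrt_mul_pos (hκ : 0 < κ) {r : ℝ} (hr₀ : 0 ≤ r) (hr : r < modelDiam κ / 2) :
    0 < cos (√κ * r) := by
  have hpos : 0 ≤ √κ * r := by positivity
  have hlt : √κ * (2 * r) < π := sqrt_mul_lt_pi hκ (by linarith)
  exact cos_pos_of_mem_Ioo ⟨by linarith [pi_pos], by linarith⟩

end ModelSpace

section Geodesic

variable {X : Type*} {d : X → X → ℝ} {γ : ℝ → X} {x y : X} {t : ℝ}

theorem IsGeodesic.apply_left (hγ : IsGeodesic d γ x y) (ht : t ∈ Set.Icc (0 : ℝ) 1) :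
    d (γ t) x = d x y * t := by
  have h := hγ.2.2 t ht 0 (by simp)
  rwa [hγ.1, sub_zero, abs_of_nonneg ht.1] at h

theorem IsGeodesic.apply_right (hγ : IsGeodesic d γ x y) (ht : t ∈ Set.Icc (0 : ℝ) 1) :
    d (γ t) y = d x y * (1 - t) := by
  have h := hγ.2.2 t ht 1 (by simp)
  rwa [hγ.2.1, abs_sub_comm, abs_of_nonneg (sub_nonneg.2 ht.2)] at h

end Geodesic

section Perimeter

variable {X : Type*} [PseudoMetricSpace X] {x y z : X} {r : ℝ}

theorem perimeter_lt_of_dist_lt (hy : dist x y < r / 2) (hz : dist x z < r / 2) :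
    dist x y + dist y z + dist z x < 2 * r := by
  linarith [dist_triangle_left y z x, dist_comm z x]

theorem dist_lt_of_perimeter_lt (h : dist x y + dist y z + dist z x < 2 * r) : dist x y < r := by
  linarith [dist_triangle_right x y z, dist_comm z x]

theorem IsGeodesic.dist_lt_of_perimeter_lt {γ : ℝ → X} (hγ : IsGeodesic dist γ y z) {t : ℝ}
    (ht : t ∈ Set.Icc (0 : ℝ) 1) (h : dist x y + dist y z + dist z x < 2 * r) :
    dist x (γ t) < r := by
  linarith [dist_triangle_right x (γ t) y, dist_triangle_right x (γ t) z, dist_comm z x,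
    hγ.apply_left ht, hγ.apply_right ht]

end Perimeter

section CAT

variable {M : Type*} [MetricSpace M] {κ : ℝ} {C : Set M} {x y z p : M} {γ : ℝ → M} {t : ℝ}

theorem IsCAT.dist_le_modelDist (hκ : 0 < κ) (hM : IsCAT κ M) (hγ : IsGeodesic dist γ y z)
    (ht : t ∈ Set.Icc (0 : ℝ) 1)
    (hper : dist x y + dist y z + dist z x < 2 * modelDiam κ) {u v w : ModelSphere}
    (huv : modelDist κ u v = dist x y) (hvw : modelDist κ v w = dist y z)
    (hwu : modelDist κ w u = dist z x) {δ : ℝ → ModelSphere}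
    (hδ : IsGeodesic (modelDist κ) δ v w) : dist x (γ t) ≤ modelDist κ u (δ t) := by
  have hxy : dist x y < modelDiam κ := dist_lt_of_perimeter_lt hper
  have hzx : dist z x < modelDiam κ := dist_lt_of_perimeter_lt (z := y) (by linarith)
  obtain ⟨γ₀, hγ₀⟩ := hM.1 x y hxy
  obtain ⟨γ₂, hγ₂⟩ := hM.1 z x hzx
  obtain ⟨δ₀, hδ₀, -⟩ := exists_isGeodesic_modelDist hκ (huv.trans_lt hxy)
  obtain ⟨δ₂, hδ₂, -⟩ := exists_isGeodesic_modelDist hκ (hwu.trans_lt hzx)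
  have htriangle : IsGeodesicTriangle dist ![x, y, z] ![γ₀, γ, γ₂] := by
    intro i; fin_cases i <;> assumption
  have hcomparison : IsComparisonTriangle κ ![x, y, z] ![u, v, w] ![δ₀, δ, δ₂] := by
    refine ⟨by intro i; fin_cases i <;> assumption, fun i j => ?_⟩
    fin_cases i <;> fin_cases j <;>
      simp [modelDist_self, huv, hvw, hwu, modelDist_comm κ v u, modelDist_comm κ w v,
        modelDist_comm κ u w, dist_comm]
  exact hM.2 _ _ htriangle hper _ _ hcomparison 0 1 x ⟨0, by simp, hγ₀.1⟩ (γ t) ⟨t, ht, rfl⟩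
    u ⟨0, by simp, hδ₀.1⟩ (δ t) ⟨t, ht, rfl⟩ ((dist_self x).trans (modelDist_self κ u).symm)
    ((hγ.apply_left ht).trans (by rw [← hvw]; exact (hδ.apply_left ht).symm))

theorem IsCAT.stewart (hκ : 0 < κ) (hM : IsCAT κ M) (hγ : IsGeodesic dist γ y z)
    (ht : t ∈ Set.Icc (0 : ℝ) 1)
    (hper : dist x y + dist y z + dist z x < 2 * modelDiam κ) :
    sin ((1 - t) * (√κ * dist y z)) * cos (√κ * dist x y) +
        sin (t * (√κ * dist y z)) * cos (√κ * dist x z) ≤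
      sin (√κ * dist y z) * cos (√κ * dist x (γ t)) := by
  obtain ⟨u, v, w, huv, hvw, hwu⟩ := exists_modelDist_eq hκ
    (by linarith [dist_triangle_right x y z, dist_comm z x])
    (by linarith [dist_triangle_left y z x, dist_comm z x])
    (by linarith [dist_triangle x y z, dist_comm z x]) hper.le
  have hyz : dist y z < modelDiam κ := dist_lt_of_perimeter_lt (z := x) (by linarith)
  obtain ⟨δ, hδ, hstewart⟩ := exists_isGeodesic_modelDist hκ (hvw.trans_lt hyz)
  have hle := hM.dist_le_modelDist hκ hγ ht hper huv hvw hwu hδ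
  have hcos : cos (√κ * modelDist κ u (δ t)) ≤ cos (√κ * dist x (γ t)) := by
    refine cos_le_cos_of_nonneg_of_le_pi (by positivity) ?_ (by gcongr)
    rw [sqrt_mul_modelDist hκ]
    exact angle_le_pi _ _
  have hsin : 0 ≤ sin (√κ * dist y z) := by
    rw [← hvw, sqrt_mul_modelDist hκ]
    exact sin_angle_nonneg _ _
  have h := hstewart u t
  rw [huv, hvw, modelDist_comm κ u w, hwu, dist_comm z x] at h
  rw [← h]
  gcongr

theorem IsCAT.cos_add_cos_le_of_midpoint (hκ : 0 < κ) (hM : IsCAT κ M)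
    (hγ : IsGeodesic dist γ y z) (hper : dist x y + dist y z + dist z x < 2 * modelDiam κ) :
    cos (√κ * dist x y) + cos (√κ * dist x z) ≤
      2 * cos (√κ * dist y z / 2) * cos (√κ * dist x (γ (1 / 2))) := by
  have hhalf : (1 / 2 : ℝ) ∈ Set.Icc (0 : ℝ) 1 := by norm_num
  rcases eq_or_ne y z with rfl | hyz
  · have hmid : γ (1 / 2) = y := by
      rw [← dist_eq_zero, hγ.apply_left hhalf, dist_self, zero_mul]
    rw [hmid, dist_self, mul_zero, zero_div, cos_zero]
    linarith
  set l := √κ * dist y z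
  have hl₀ : 0 < l := mul_pos (sqrt_pos.2 hκ) (dist_pos.2 hyz)
  have hlπ : l < π :=
    sqrt_mul_lt_pi hκ (dist_lt_of_perimeter_lt (z := x) (by linarith))
  have h := hM.stewart hκ hγ hhalf hper
  rw [show (1 - 1 / 2) * l = l / 2 by ring, show 1 / 2 * l = l / 2 by ring,
    show sin l = 2 * sin (l / 2) * cos (l / 2) by rw [← sin_two_mul]; ring_nf] at h
  refine le_of_mul_le_mul_left ?_ (sin_pos_of_pos_of_lt_pi (half_pos hl₀) (by linarith))
  linarith

theorem IsNearestPoint.dist_le (hp : IsNearestPoint C x p) (hz : z ∈ C) : dist x p ≤ dist x z :=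
  hp.2.trans_le (Metric.infDist_le_dist_of_mem hz)

/-- Stewart's inequality along the geodesic from `p` to `z` is differentiated at its endpoint `p`,
where the distance to `x` is minimal. -/
theorem IsCAT.cos_le_cos_mul_cos_of_isNearestPoint (hκ : 0 < κ) (hM : IsCAT κ M)
    (hC : IsConvex C) (hp : IsNearestPoint C x p) (hz : z ∈ C)
    (hper : dist x p + dist p z + dist z x < 2 * modelDiam κ) :
    cos (√κ * dist x z) ≤ cos (√κ * dist x p) * cos (√κ * dist p z) := by
  rcases eq_or_ne p z with rfl | hpz
  · simp
  obtain ⟨⟨γ, hγ⟩, hγC⟩ := hC p hp.1 z hz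
  set l := √κ * dist p z
  have hl₀ : 0 < l := mul_pos (sqrt_pos.2 hκ) (dist_pos.2 hpz)
  have hlπ : l < π :=
    sqrt_mul_lt_pi hκ (dist_lt_of_perimeter_lt (z := x) (by linarith))
  let f : ℝ → ℝ := fun t =>
    sin ((1 - t) * l) * cos (√κ * dist x p) + sin (t * l) * cos (√κ * dist x z)
  have hmax : IsMaxOn f (Set.Icc 0 1) 0 := by
    intro t ht
    have hnear : dist x p ≤ dist x (γ t) := hp.dist_le (hγC γ hγ ⟨t, ht, rfl⟩)
    have hfar : dist x (γ t) ≤ modelDiam κ := (hγ.dist_lt_of_perimeter_lt ht hper).le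
    calc f t ≤ sin l * cos (√κ * dist x (γ t)) := hM.stewart hκ hγ ht hper
      _ ≤ sin l * cos (√κ * dist x p) := by
        refine mul_le_mul_of_nonneg_left ?_ (sin_pos_of_pos_of_lt_pi hl₀ hlπ).le
        exact (cos_sqrt_mul_le_cos_sqrt_mul_iff hκ dist_nonneg hfar dist_nonneg
          (hnear.trans hfar)).2 hnear
      _ = f 0 := by simp [f]
  have hderiv : HasDerivAt f
      (l * (cos (√κ * dist x z) - cos (√κ * dist x p) * cos l)) 0 := by
    have h := ((((hasDerivAt_id (0 : ℝ)).const_sub 1).mul_const l).sin.mul_const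
      (cos (√κ * dist x p))).add
      (((hasDerivAt_id (0 : ℝ)).mul_const l).sin.mul_const (cos (√κ * dist x z)))
    refine h.congr_deriv ?_
    simp only [id_eq, sub_zero, one_mul, neg_mul, mul_neg, zero_mul, cos_zero]
    ring
  have hright : (1 : ℝ) ∈ posTangentConeAt (Set.Icc 0 1) 0 :=
    mem_posTangentConeAt_of_segment_subset (by rw [zero_add, segment_eq_Icc zero_le_one])
  have hle : l * (cos (√κ * dist x z) - cos (√κ * dist x p) * cos l) ≤ 0 := by
    simpa using hmax.localize.hasFDerivWithinAt_nonpos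
      hderiv.hasFDerivAt.hasFDerivWithinAt hright
  exact sub_nonpos.1 (nonpos_of_mul_nonpos_right hle hl₀)

end CAT

section NearestPoint

variable {M : Type*} [MetricSpace M] {κ : ℝ} {C : Set M} {x y z p : M}

theorem IsNearestPoint.metricProj (hp : IsNearestPoint C x p) :
    IsNearestPoint C x (metricProj C x) := by
  rw [CatKappa.metricProj, dif_pos ⟨p, hp⟩]
  exact Exists.choose_spec _

theorem IsCAT.cos_add_cos_le_cos_infDist (hκ : 0 < κ) (hM : IsCAT κ M) (hC : IsConvex C)
    (hy : y ∈ C) (hz : z ∈ C) (hper : dist x y + dist y z + dist z x < 2 * modelDiam κ) :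
    cos (√κ * dist x y) + cos (√κ * dist x z) ≤
      2 * cos (√κ * dist y z / 2) * cos (√κ * Metric.infDist x C) := by
  obtain ⟨⟨γ, hγ⟩, hγC⟩ := hC y hy z hz
  have hhalf : (1 / 2 : ℝ) ∈ Set.Icc (0 : ℝ) 1 := by norm_num
  have hle : Metric.infDist x C ≤ dist x (γ (1 / 2)) :=
    Metric.infDist_le_dist_of_mem (hγC γ hγ ⟨1 / 2, hhalf, rfl⟩)
  have hlt : dist x (γ (1 / 2)) < modelDiam κ := hγ.dist_lt_of_perimeter_lt hhalf hper
  have hyz₀ : 0 ≤ √κ * dist y z := by positivity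
  have hyzπ : √κ * dist y z < π :=
    sqrt_mul_lt_pi hκ (dist_lt_of_perimeter_lt (z := x) (by linarith))
  have hcos : 0 ≤ cos (√κ * dist y z / 2) :=
    cos_nonneg_of_mem_Icc ⟨by linarith, by linarith⟩
  refine (hM.cos_add_cos_le_of_midpoint hκ hγ hper).trans ?_
  gcongr ?_ * ?_
  exact (cos_sqrt_mul_le_cos_sqrt_mul_iff hκ dist_nonneg hlt.le Metric.infDist_nonneg
    (hle.trans hlt.le)).2 hle

theorem IsCAT.exists_forall_dist_lt_of_dist_lt_infDist_add (hκ : 0 < κ) (hM : IsCAT κ M)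
    (hC : IsConvex C) (hx : Metric.infDist x C < modelDiam κ / 2) {ε : ℝ} (hε : 0 < ε) :
    ∃ δ > 0, ∀ y ∈ C, ∀ z ∈ C, dist x y < Metric.infDist x C + δ →
      dist x z < Metric.infDist x C + δ → dist y z < ε := by
  set r := Metric.infDist x C
  have hcos_r : 0 < cos (√κ * r) := cos_sqrt_mul_pos hκ Metric.infDist_nonneg hx
  set θ := min (√κ * ε / 2) (π / 2)
  have hθ₀ : 0 < θ := lt_min (by positivity) (by positivity)
  have hcos_θ : cos θ < 1 := by
    rw [← cos_zero]
    exact cos_lt_cos_of_nonneg_of_le_pi_div_two le_rfl (min_le_right _ _) hθ₀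
  obtain ⟨δ, hδ, hball⟩ : ∃ δ > 0, ∀ s, dist s r < δ →
      s < modelDiam κ / 2 ∧ cos θ * cos (√κ * r) < cos (√κ * s) := by
    have hcont : Continuous fun s => cos (√κ * s) := by fun_prop
    exact Metric.eventually_nhds_iff.1 ((gt_mem_nhds hx).and
      ((hcont.tendsto r).eventually (lt_mem_nhds (mul_lt_of_lt_one_left hcos_r hcos_θ))))
  have hnear : ∀ c ∈ C, dist x c < r + δ →
      dist x c < modelDiam κ / 2 ∧ cos θ * cos (√κ * r) < cos (√κ * dist x c) := by
    intro c hc hlt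
    have hle : r ≤ dist x c := Metric.infDist_le_dist_of_mem hc
    exact hball _ (by rw [Real.dist_eq, abs_of_nonneg (by linarith)]; linarith)
  refine ⟨δ, hδ, fun y hy z hz hxy hxz => ?_⟩
  obtain ⟨hxy, hcos_xy⟩ := hnear y hy hxy
  obtain ⟨hxz, hcos_xz⟩ := hnear z hz hxz
  have hper := perimeter_lt_of_dist_lt hxy hxz
  have hyzπ : √κ * dist y z < π :=
    sqrt_mul_lt_pi hκ (dist_lt_of_perimeter_lt (z := x) (by linarith))
  by_contra! hyz
  have hcos_yz : cos (√κ * dist y z / 2) ≤ cos θ := by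
    refine cos_le_cos_of_nonneg_of_le_pi hθ₀.le (by linarith [pi_pos]) ((min_le_left _ _).trans ?_)
    gcongr
  have hsum := hM.cos_add_cos_le_cos_infDist hκ hC hy hz hper
  linarith [mul_le_mul_of_nonneg_right hcos_yz hcos_r.le]

theorem IsCAT.exists_isNearestPoint (hκ : 0 < κ) (hM : IsCAT κ M) (hC : IsConvex C)
    (hcomplete : IsComplete C) (hne : C.Nonempty) (hx : Metric.infDist x C < modelDiam κ / 2) :
    ∃ p, IsNearestPoint C x p := by
  have hseq : ∀ n : ℕ, ∃ c ∈ C, dist x c < Metric.infDist x C + 1 / ((n : ℝ) + 1) := fun n =>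
    (Metric.infDist_lt_iff hne).1 (lt_add_of_pos_right _ Nat.one_div_pos_of_nat)
  choose c hcC hc using hseq
  have hlim : Tendsto (fun n => dist x (c n)) atTop (𝓝 (Metric.infDist x C)) := by
    refine tendsto_of_tendsto_of_tendsto_of_le_of_le tendsto_const_nhds ?_
      (fun n => Metric.infDist_le_dist_of_mem (hcC n)) (fun n => (hc n).le)
    simpa using tendsto_const_nhds.add (tendsto_one_div_add_atTop_nhds_zero_nat (𝕜 := ℝ))
  have hcauchy : CauchySeq c := by
    refine Metric.cauchySeq_iff.2 fun ε hε => ?_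
    obtain ⟨δ, hδ, hclose⟩ := hM.exists_forall_dist_lt_of_dist_lt_infDist_add hκ hC hx hε
    obtain ⟨N, hN⟩ := eventually_atTop.1
      (hlim.eventually (gt_mem_nhds (lt_add_of_pos_right _ hδ)))
    exact ⟨N, fun m hm n hn => hclose _ (hcC m) _ (hcC n) (hN m hm) (hN n hn)⟩
  obtain ⟨p, hpC, hp⟩ := cauchySeq_tendsto_of_isComplete hcomplete hcC hcauchy
  exact ⟨p, hpC, tendsto_nhds_unique (tendsto_const_nhds.dist hp) hlim⟩

theorem IsCAT.isNearestPoint_metricProj (hκ : 0 < κ) (hM : IsCAT κ M) (hC : IsConvex C)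
    (hcomplete : IsComplete C) (hz : z ∈ C) (hxz : dist x z < modelDiam κ / 2) :
    IsNearestPoint C x (CatKappa.metricProj C x) := by
  obtain ⟨p, hp⟩ := hM.exists_isNearestPoint hκ hC hcomplete ⟨z, hz⟩
    ((Metric.infDist_le_dist_of_mem hz).trans_lt hxz)
  exact hp.metricProj

theorem IsCAT.dist_le_of_isNearestPoint (hκ : 0 < κ) (hM : IsCAT κ M) (hC : IsConvex C)
    (hp : IsNearestPoint C x p) (hz : z ∈ C) (hxz : dist x z < modelDiam κ / 2) :
    dist p z ≤ dist x z := by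
  have hxp : dist x p < modelDiam κ / 2 := (hp.dist_le hz).trans_lt hxz
  have hper := perimeter_lt_of_dist_lt hxp hxz
  have hpz : dist p z < modelDiam κ := dist_lt_of_perimeter_lt (z := x) (by linarith)
  have hxz' : dist x z ≤ modelDiam κ := by linarith [dist_nonneg (x := x) (y := z)]
  have hpyth := hM.cos_le_cos_mul_cos_of_isNearestPoint hκ hC hp hz hper
  have hcos_pz : 0 < cos (√κ * dist p z) :=
    pos_of_mul_pos_right ((cos_sqrt_mul_pos hκ dist_nonneg hxz).trans_le hpyth)
      (cos_sqrt_mul_pos hκ dist_nonneg hxp).le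
  rw [← cos_sqrt_mul_le_cos_sqrt_mul_iff hκ dist_nonneg hxz' dist_nonneg hpz.le]
  exact hpyth.trans (mul_le_of_le_one_left hcos_pz.le (cos_le_one _))

end NearestPoint

section HopfRinow

theorem totallyBounded_of_forall_subset_thickening {X : Type*} [PseudoMetricSpace X] {s : Set X}
    (h : ∀ ε > 0, ∃ K, TotallyBounded K ∧ s ⊆ Metric.thickening ε K) : TotallyBounded s := by
  refine Metric.totallyBounded_iff.2 fun ε hε => ?_
  obtain ⟨K, hK, hsK⟩ := h (ε / 2) (half_pos hε)
  obtain ⟨F, hF, hKF⟩ := Metric.totallyBounded_iff.1 hK (ε / 2) (half_pos hε)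
  refine ⟨F, hF, ?_⟩
  rw [← Metric.thickening_eq_biUnion_ball] at hKF ⊢
  calc s ⊆ Metric.thickening (ε / 2) K := hsK
    _ ⊆ Metric.thickening (ε / 2) (Metric.thickening (ε / 2) F) :=
      Metric.thickening_subset_of_subset _ hKF
    _ ⊆ Metric.thickening ε F := by
      simpa only [add_halves] using Metric.thickening_thickening_subset (ε / 2) (ε / 2) F

/-- The Hopf–Rinow theorem; `hthick` holds in every length space. The radii of compact balls form
a set that is closed by total boundedness and open to the right by local compactness. -/
theorem isCompact_closedBall_of_subset_cthickening {X : Type*} [PseudoMetricSpace X]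
    [CompleteSpace X] [LocallyCompactSpace X] {a : X}
    (hthick : ∀ r δ, 0 ≤ r → 0 ≤ δ →
      Metric.closedBall a (r + δ) ⊆ Metric.cthickening δ (Metric.closedBall a r)) (R : ℝ) :
    IsCompact (Metric.closedBall a R) := by
  have hmono : ∀ {r s : ℝ}, r ≤ s → IsCompact (Metric.closedBall a s) →
      IsCompact (Metric.closedBall a r) := fun hrs hs =>
    hs.of_isClosed_subset Metric.isClosed_closedBall (Metric.closedBall_subset_closedBall hrs)
  have hzero : IsCompact (Metric.closedBall a 0) := by
    rw [Metric.closedBall_zero']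
    exact isCompact_singleton.closure
  rcases le_total R 0 with hR | hR
  · exact hmono hR hzero
  let S : Set ℝ := {r | IsCompact (Metric.closedBall a r)}
  suffices h : Set.Icc 0 R ⊆ S from h ⟨hR, le_rfl⟩
  refine IsClosed.Icc_subset_of_forall_exists_gt ?_ hzero ?_
  · refine isClosed_of_closure_subset fun s hs =>
      ⟨?_, closure_minimal Set.inter_subset_right isClosed_Icc hs⟩
    refine isCompact_iff_totallyBounded_isComplete.2
      ⟨totallyBounded_of_forall_subset_thickening fun ε hε => ?_,
        Metric.isClosed_closedBall.isComplete⟩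
    obtain ⟨r, ⟨hrS, hrI⟩, hr⟩ := Metric.mem_closure_iff.1 hs ε hε
    exact ⟨_, hrS.totallyBounded, calc
      Metric.closedBall a s ⊆ Metric.closedBall a (r + |s - r|) :=
        Metric.closedBall_subset_closedBall (by linarith [le_abs_self (s - r)])
      _ ⊆ Metric.cthickening |s - r| (Metric.closedBall a r) := hthick _ _ hrI.1 (abs_nonneg _)
      _ ⊆ Metric.thickening ε (Metric.closedBall a r) :=
        Metric.cthickening_subset_thickening' hε hr _⟩
  · rintro r ⟨hrS, hrI⟩ s hs
    obtain ⟨δ, hδ, hcompact⟩ := IsCompact.exists_isCompact_cthickening hrS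
    have hrδ : r + δ ∈ S :=
      hcompact.of_isClosed_subset Metric.isClosed_closedBall (hthick r δ hrI.1 hδ.le)
    exact ⟨min s (r + δ), hmono (min_le_right _ _) hrδ, lt_min hs (by linarith), min_le_left _ _⟩

theorem IsConvex.isCompact_inter_closedBall {M : Type*} [MetricSpace M] {C : Set M} {a : M}
    [LocallyCompactSpace C] (hC : IsConvex C) (hcomplete : IsComplete C) (ha : a ∈ C) (R : ℝ) :
    IsCompact (C ∩ Metric.closedBall a R) := by
  have := hcomplete.completeSpace_coe
  have hcompact : IsCompact (Metric.closedBall (⟨a, ha⟩ : C) R) := by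
    refine isCompact_closedBall_of_subset_cthickening (fun r δ hr hδ => ?_) R
    rintro ⟨y, hy⟩ hay
    replace hay : dist a y ≤ r + δ := by rwa [dist_comm]
    obtain ⟨⟨γ, hγ⟩, hγC⟩ := hC a ha y hy
    set t := r / (r + δ)
    have htI : t ∈ Set.Icc (0 : ℝ) 1 :=
      ⟨by positivity, div_le_one_of_le₀ (by linarith) (by linarith)⟩
    have hrt : (r + δ) * t = r := mul_div_cancel_of_imp' fun h => by linarith
    refine Metric.mem_cthickening_of_dist_le _ ⟨γ t, hγC γ hγ ⟨t, htI, rfl⟩⟩ _ _ ?_ ?_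
    · calc dist (γ t) a = dist a y * t := hγ.apply_left htI
        _ ≤ (r + δ) * t := by gcongr
        _ = r := hrt
    · calc dist y (γ t) = dist a y * (1 - t) := (dist_comm _ _).trans (hγ.apply_right htI)
        _ ≤ (r + δ) * (1 - t) := by gcongr; linarith [htI.2]
        _ = δ := by linarith
  have himage := hcompact.image continuous_subtype_val
  rwa [Subtype.image_closedBall, Set.inter_comm] at himage

end HopfRinow

section AsymptoticRegularity

theorem tendsto_zero_of_tendsto_cos_one {ι : Type*} {l : Filter ι} {f : ι → ℝ}
    (hf₀ : ∀ i, 0 ≤ f i) (hfπ : ∀ i, f i ≤ π) (h : Tendsto (fun i => cos (f i)) l (𝓝 1)) :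
    Tendsto f l (𝓝 0) := by
  have harccos := (continuous_arccos.tendsto 1).comp h
  rw [arccos_one] at harccos
  exact harccos.congr fun i => arccos_cos (hf₀ i) (hfπ i)

theorem frequently_mem_of_eventually_mem_or_mem_succ {α : Type*} {S : Set α} {x : ℕ → α}
    (hvisit : ∀ᶠ n in atTop, x n ∈ S ∨ x (n + 1) ∈ S) : ∃ᶠ n in atTop, x n ∈ S :=
  (frequently_or_distrib.1 hvisit.frequently).elim id
    ((tendsto_add_atTop_nat 1).frequently (p := (x · ∈ S)))

theorem mem_of_tendsto_comp_of_tendsto_dist_succ {X : Type*} [PseudoMetricSpace X] {S : Set X}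
    {x : ℕ → X} {p : X} (hS : IsClosed S)
    (hreg : Tendsto (fun n => dist (x n) (x (n + 1))) atTop (𝓝 0))
    (hvisit : ∀ᶠ n in atTop, x n ∈ S ∨ x (n + 1) ∈ S) {φ : ℕ → ℕ} (hφ : Tendsto φ atTop atTop)
    (hp : Tendsto (x ∘ φ) atTop (𝓝 p)) : p ∈ S := by
  rw [← hS.closure_eq, Metric.mem_closure_iff]
  intro ε hε
  have hsum : Tendsto (fun n => dist (x (φ n)) (x (φ n + 1)) + dist (x (φ n)) p) atTop (𝓝 0) := by
    simpa using (hreg.comp hφ).add (tendsto_iff_dist_tendsto_zero.1 hp)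
  obtain ⟨n, hn, hnS | hnS⟩ :=
    ((hsum.eventually (gt_mem_nhds hε)).and (hφ.eventually hvisit)).exists
  · have hnonneg : 0 ≤ dist (x (φ n)) (x (φ n + 1)) := dist_nonneg
    exact ⟨_, hnS, by linarith [dist_comm p (x (φ n))]⟩
  · exact ⟨_, hnS, by linarith [dist_triangle_left p (x (φ n + 1)) (x (φ n))]⟩

end AsymptoticRegularity

section ProjectionSequence

variable {M : Type*} [MetricSpace M] {κ : ℝ} {C : ℕ → Set M} {x : ℕ → M} {z p : M}

theorem IsCAT.isNearestPoint_of_forall_succ_eq_metricProj (hκ : 0 < κ) (hM : IsCAT κ M)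
    (hC : ∀ n, IsConvex (C n)) (hcomplete : ∀ n, IsComplete (C n)) (hz : ∀ n, z ∈ C n)
    (hx : ∀ n, x (n + 1) = metricProj (C n) (x n)) (hx₀ : dist (x 0) z < modelDiam κ / 2) (n : ℕ) :
    IsNearestPoint (C n) (x n) (x (n + 1)) := by
  have hstep : ∀ n, dist (x n) z < modelDiam κ / 2 → IsNearestPoint (C n) (x n) (x (n + 1)) := by
    intro n hn
    rw [hx n]
    exact hM.isNearestPoint_metricProj hκ (hC n) (hcomplete n) (hz n) hn
  refine hstep n ?_
  induction n with
  | zero => exact hx₀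
  | succ n ih =>
    exact (hM.dist_le_of_isNearestPoint hκ (hC n) (hstep n ih) (hz n) ih).trans_lt ih

theorem IsCAT.dist_le_of_forall_isNearestPoint (hκ : 0 < κ) (hM : IsCAT κ M)
    (hC : ∀ n, IsConvex (C n)) (hz : ∀ n, z ∈ C n)
    (hx : ∀ n, IsNearestPoint (C n) (x n) (x (n + 1))) {m n : ℕ} (hmn : m ≤ n)
    (hm : dist (x m) z < modelDiam κ / 2) : dist (x n) z ≤ dist (x m) z := by
  induction n, hmn using Nat.le_induction with
  | base => rfl
  | succ n _ ih =>
    exact (hM.dist_le_of_isNearestPoint hκ (hC n) (hx n) (hz n) (ih.trans_lt hm)).trans ih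

theorem IsCAT.tendsto_dist_succ_of_forall_isNearestPoint (hκ : 0 < κ) (hM : IsCAT κ M)
    (hC : ∀ n, IsConvex (C n)) (hz : ∀ n, z ∈ C n)
    (hx : ∀ n, IsNearestPoint (C n) (x n) (x (n + 1))) (hx₀ : dist (x 0) z < modelDiam κ / 2) :
    Tendsto (fun n => dist (x n) (x (n + 1))) atTop (𝓝 0) := by
  have hlt : ∀ n, dist (x n) z < modelDiam κ / 2 := fun n =>
    (hM.dist_le_of_forall_isNearestPoint hκ hC hz hx n.zero_le hx₀).trans_lt hx₀
  have hanti : Antitone fun n => dist (x n) z := fun m n hmn =>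
    hM.dist_le_of_forall_isNearestPoint hκ hC hz hx hmn (hlt m)
  have hlim := tendsto_atTop_ciInf hanti ⟨0, by rintro _ ⟨n, rfl⟩; exact dist_nonneg⟩
  set r := ⨅ n, dist (x n) z
  have hr : r < modelDiam κ / 2 := (hanti.le_of_tendsto hlim 0).trans_lt hx₀
  have hper : ∀ n, dist (x n) (x (n + 1)) + dist (x (n + 1)) z + dist z (x n) <
      2 * modelDiam κ := fun n =>
    perimeter_lt_of_dist_lt (((hx n).dist_le (hz n)).trans_lt (hlt n)) (hlt n)
  have hcos_lim : Tendsto (fun n => cos (√κ * dist (x n) z)) atTop (𝓝 (cos (√κ * r))) :=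
    (continuous_cos.tendsto _).comp (hlim.const_mul _)
  have hquotient : Tendsto (fun n => cos (√κ * dist (x n) z) / cos (√κ * dist (x (n + 1)) z))
      atTop (𝓝 1) := by
    have hne := (cos_sqrt_mul_pos hκ (Real.iInf_nonneg fun _ => dist_nonneg) hr).ne'
    rw [← div_self hne]
    exact hcos_lim.div (hcos_lim.comp (tendsto_add_atTop_nat 1)) hne
  have hcos : Tendsto (fun n => cos (√κ * dist (x n) (x (n + 1)))) atTop (𝓝 1) := by
    refine tendsto_of_tendsto_of_tendsto_of_le_of_le hquotient tendsto_const_nhds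
      (fun n => ?_) (fun n => cos_le_one _)
    exact (div_le_iff₀ (cos_sqrt_mul_pos hκ dist_nonneg (hlt (n + 1)))).2
      (hM.cos_le_cos_mul_cos_of_isNearestPoint hκ (hC n) (hx n) (hz n) (hper n))
  have hangle : Tendsto (fun n => √κ * dist (x n) (x (n + 1))) atTop (𝓝 0) :=
    tendsto_zero_of_tendsto_cos_one (fun n => by positivity)
      (fun n => (sqrt_mul_lt_pi hκ (dist_lt_of_perimeter_lt (hper n))).le) hcos
  simpa [(sqrt_pos.2 hκ).ne'] using hangle.const_mul (√κ)⁻¹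

theorem IsCAT.tendsto_of_tendsto_comp_of_forall_isNearestPoint (hκ : 0 < κ) (hM : IsCAT κ M)
    (hC : ∀ n, IsConvex (C n)) (hp : ∀ n, p ∈ C n)
    (hx : ∀ n, IsNearestPoint (C n) (x n) (x (n + 1))) {φ : ℕ → ℕ}
    (hφ : Tendsto (x ∘ φ) atTop (𝓝 p)) : Tendsto x atTop (𝓝 p) := by
  have hdiam : 0 < modelDiam κ / 2 := half_pos (div_pos pi_pos (sqrt_pos.2 hκ))
  refine Metric.tendsto_atTop.2 fun ε hε => ?_
  obtain ⟨k, hk⟩ :=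
    ((tendsto_iff_dist_tendsto_zero.1 hφ).eventually (gt_mem_nhds (lt_min hε hdiam))).exists
  exact ⟨φ k, fun n hn => (hM.dist_le_of_forall_isNearestPoint hκ hC hp hx hn
    (hk.trans_le (min_le_right _ _))).trans_lt (hk.trans_le (min_le_left _ _))⟩

theorem IsConvex.exists_tendsto_subseq {S : Set M} [LocallyCompactSpace S] (hS : IsConvex S)
    (hcomplete : IsComplete S) (hz : z ∈ S) {R : ℝ} (hbdd : ∀ n, dist (x n) z ≤ R)
    (hfreq : ∃ᶠ n in atTop, x n ∈ S) :
    ∃ p, ∃ φ : ℕ → ℕ, StrictMono φ ∧ Tendsto (x ∘ φ) atTop (𝓝 p) := by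
  obtain ⟨p, -, φ, hφ, hp⟩ := (hS.isCompact_inter_closedBall hcomplete hz R).tendsto_subseq'
    (hfreq.mono fun n hn => ⟨hn, hbdd n⟩)
  exact ⟨p, φ, hφ, hp⟩

end ProjectionSequence

section AlternatingProjection

variable {α : Type*} {A B : Set α} {x : ℕ → α}

/-- The sets `A, B, A, B, …` onto which the alternating projection method projects the points
`x 0, x 1, x 2, x 3, …`. -/
def alternatingSet (A B : Set α) (n : ℕ) : Set α := if Even n then A else B

theorem forall_alternatingSet {P : Set α → Prop} (hA : P A) (hB : P B) (n : ℕ) :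
    P (alternatingSet A B n) := by
  unfold alternatingSet
  split_ifs <;> assumption

theorem eventually_mem_left_of_mem_alternatingSet (hx : ∀ n, x (n + 1) ∈ alternatingSet A B n) :
    ∀ᶠ n in atTop, x n ∈ A ∨ x (n + 1) ∈ A := by
  refine Eventually.of_forall fun n => ?_
  obtain ⟨k, rfl | rfl⟩ := n.even_or_odd'
  · exact .inr (by simpa [alternatingSet] using hx (2 * k))
  · exact .inl (by simpa [alternatingSet] using hx (2 * k))

theorem eventually_mem_right_of_mem_alternatingSet (hx : ∀ n, x (n + 1) ∈ alternatingSet A B n) :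
    ∀ᶠ n in atTop, x n ∈ B ∨ x (n + 1) ∈ B := by
  refine (eventually_gt_atTop 0).mono fun n hn => ?_
  obtain ⟨n, rfl⟩ := Nat.exists_eq_succ_of_ne_zero hn.ne'
  obtain ⟨k, rfl | rfl⟩ := n.even_or_odd'
  · exact .inr (by simpa [alternatingSet, Nat.even_add_one] using hx (2 * k + 1))
  · exact .inl (by simpa [alternatingSet, Nat.even_add_one] using hx (2 * k + 1))

theorem IsAlternatingProjectionSeq.succ_eq {M : Type*} [MetricSpace M] {A B : Set M}
    {x : ℕ → M} (hx : IsAlternatingProjectionSeq A B x) (n : ℕ) :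
    x (n + 1) = metricProj (alternatingSet A B n) (x n) := by
  obtain ⟨k, rfl | rfl⟩ := n.even_or_odd'
  · simpa [alternatingSet] using (hx k).1
  · simpa [alternatingSet, Nat.even_add_one] using (hx k).2

end AlternatingProjection

theorem dist_lt_of_ediam_univ_lt {X : Type*} [PseudoMetricSpace X] {r : ℝ}
    (h : Metric.ediam (Set.univ : Set X) < ENNReal.ofReal r) (x y : X) : dist x y < r := by
  rw [← ENNReal.ofReal_lt_ofReal_iff_of_nonneg dist_nonneg, ← edist_dist]
  exact (Metric.edist_le_ediam_of_mem (Set.mem_univ _) (Set.mem_univ _)).trans_lt h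

end CatKappa

open CatKappa in
theorem mainTheorem4_general {M : Type*} [MetricSpace M] {κ : ℝ} (hκ : 0 < κ) (hM : IsCAT κ M)
    {A B : Set M} (hAconv : IsConvex A) (hBconv : IsConvex B) (hA : IsComplete A)
    (hB : IsComplete B) {z : M} (hz : z ∈ A ∩ B) {x : ℕ → M}
    (hx : IsAlternatingProjectionSeq A B x) (hx₀z : dist (x 0) z < modelDiam κ / 2)
    (hloc : LocallyCompactSpace A ∨ LocallyCompactSpace B) :
    ∃ p ∈ A ∩ B, Tendsto x atTop (𝓝 p) := by
  have hconv := forall_alternatingSet hAconv hBconv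
  have hz_mem : ∀ n, z ∈ alternatingSet A B n := forall_alternatingSet (P := (z ∈ ·)) hz.1 hz.2
  have hnear := hM.isNearestPoint_of_forall_succ_eq_metricProj hκ hconv
    (forall_alternatingSet hA hB) hz_mem hx.succ_eq hx₀z
  have hreg := hM.tendsto_dist_succ_of_forall_isNearestPoint hκ hconv hz_mem hnear hx₀z
  have hbdd := fun n : ℕ =>
    hM.dist_le_of_forall_isNearestPoint hκ hconv hz_mem hnear n.zero_le hx₀z
  have hvisitA := eventually_mem_left_of_mem_alternatingSet fun n => (hnear n).1
  have hvisitB := eventually_mem_right_of_mem_alternatingSet fun n => (hnear n).1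
  obtain ⟨p, φ, hφ, hp⟩ : ∃ p, ∃ φ : ℕ → ℕ, StrictMono φ ∧ Tendsto (x ∘ φ) atTop (𝓝 p) := by
    rcases hloc with _ | _
    · exact hAconv.exists_tendsto_subseq hA hz.1 hbdd
        (frequently_mem_of_eventually_mem_or_mem_succ hvisitA)
    · exact hBconv.exists_tendsto_subseq hB hz.2 hbdd
        (frequently_mem_of_eventually_mem_or_mem_succ hvisitB)
  have hpA : p ∈ A :=
    mem_of_tendsto_comp_of_tendsto_dist_succ hA.isClosed hreg hvisitA hφ.tendsto_atTop hp
  have hpB : p ∈ B :=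
    mem_of_tendsto_comp_of_tendsto_dist_succ hB.isClosed hreg hvisitB hφ.tendsto_atTop hp
  exact ⟨p, ⟨hpA, hpB⟩, hM.tendsto_of_tendsto_comp_of_forall_isNearestPoint hκ hconv
    (forall_alternatingSet (P := (p ∈ ·)) hpA hpB) hnear hp⟩

theorem mainTheorem4 {M : Type*} [MetricSpace M] [CompleteSpace M] (κ : ℝ) (hκ : 0 < κ)
    (hM : CatKappa.IsCAT κ M)
    (hdiam : Metric.ediam (Set.univ : Set M) < ENNReal.ofReal (CatKappa.modelDiam κ / 2))
    (A B : Set M) (hAne : A.Nonempty) (hBne : B.Nonempty)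
    (hAconv : CatKappa.IsConvex A) (hBconv : CatKappa.IsConvex B)
    (hAcl : IsClosed A) (hBcl : IsClosed B) (hAB : (A ∩ B).Nonempty)
    (x₀ : M) (x : ℕ → M) (hx₀ : x 0 = x₀) (hx : CatKappa.IsAlternatingProjectionSeq A B x)
    (hloc : LocallyCompactSpace A ∨ LocallyCompactSpace B) :
    ∃ p ∈ A ∩ B, Tendsto x atTop (𝓝 p) := by
  obtain ⟨z, hz⟩ := hAB
  exact mainTheorem4_general hκ hM hAconv hBconv hAcl.isComplete hBcl.isComplete hz hx
    (CatKappa.dist_lt_of_ediam_univ_lt hdiam _ _) hloc
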